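/- Let $R$ be a commutative ring with identity and let $A$ be an associative unital $R$-algebra that is a symmetric cellular algebra, as follows. *Cellular* (Graham–Lehrer), with cell datum $(\Lambda,M,C,i)$: $\Lambda$ is a finite poset, $M(\lambda)$ is a finite set for each $\lambda\in\Lambda$, and $A$ has an $R$-basis $\{C_{S,T}^\lambda \mid \lambda\in\Lambda,\ S,T\in M(\lambda)\}$; $i$ is an $R$-linear anti-automorphism of $A$ with $i^2=\mathrm{id}$ and $i(C_{S,T}^\lambda)=C_{T,S}^\lambda$; and for all $\lambda\in\Lambda$, $S,T\in M(\lambda)$ and $a\in A$, $$aC_{S,T}^\lambda\equiv\sum_{S'\in M(\lambda)} r_a(S',S)\,C_{S',T}^\lambda \pmod{A(<\lambda)},$$ where $r_a(S',S)\in R$ does not depend on $T$ and $A(<\lambda)$ is the $R$-span of all $C_{U,V}^\mu$ with $\mu<\lambda$, $U,V\in M(\mu)$. *Symmetric*: there is a symmetric bilinear form $f:A\times A\to R$ with $f(ab,c)=f(a,bc)$ for all $a,b,c\in A$ whose Gram matrix with respect to some finite $R$-basis of $A$ has determinant a unit of $R$. The linear map $\tau(a)=f(a,1)$ is then called a symmetrizing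 trace. Fix such a $\tau$, and let $\{D_{S,T}^\lambda\}$ be the dual basis of $\{C_{S,T}^\lambda\}$ determined by $\tau$, that is, $\tau(D_{U,V}^\mu C_{S,T}^\lambda)=1$ if $(\lambda,S,T)=(\mu,U,V)$ and $0$ otherwise. Let $Z(A)$ be the center of $A$. For $\lambda\in\Lambda$ and $S\in M(\lambda)$ put $x'_\lambda=\sum_{T\in M(\lambda)} D_{S,T}^\lambda C_{S,T}^\lambda$, and let $L(A)'$ be the set of all $R$-linear combinations of the elements $x'_\lambda$ (over those $\lambda\in\Lambda$ with $M(\lambda)\neq\emptyset$). Let $$H(A)=\Big\{\sum_{\lambda\in\Lambda,\ S,T\in M(\lambda)} C_{S,T}^\lambda\, a\, D_{S,T}^\lambda \;\Big|\; a\in A\Big\}$$ be the Higman ideal. Then the element $x'_\lambda$ does not depend on the choice of $S\in M(\lambda)$, and the following hold. 1. $L(A)'$ is an ideal of $Z(A)$ and contains $H(A)$. 2. $L(A)'$ does not depend on the choice of the symmetrizing trace $\tau$. 3. If $R$ is a field, then the number of isomorphism classes of simple left $A$-modules is finite and at most $\dim_R L(A)'$. -/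

import Mathlib

namespace SymCell

section SymmetricAlgebra

variable {R A : Type*} [CommRing R] [Ring A] [Algebra R A]

/-- `f` is a non-degenerate, associative, symmetric bilinear form on `A`; non-degeneracy means that
`A` has a finite `R`-basis whose Gram matrix has invertible determinant. -/
structure IsSymmetrizingForm (f : LinearMap.BilinForm R A) : Prop where
  assoc : ∀ a b c : A, f (a * b) c = f a (b * c)
  symm : ∀ a b : A, f a b = f b a
  nondegenerate : ∃ (n : ℕ) (b : Module.Basis (Fin n) R A),
    IsUnit (Matrix.of fun i j => f (b i) (b j)).det

/-- A symmetrizing trace on `A`: a linear map of the form `a ↦ f (a, 1)`, where `f` is a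
non-degenerate associative symmetric bilinear form. Thus `A` is a symmetric algebra exactly when it
has a symmetrizing trace. -/
def IsSymmetrizingTrace (τ : A →ₗ[R] R) : Prop :=
  ∃ f : LinearMap.BilinForm R A, IsSymmetrizingForm f ∧ ∀ a, τ a = f a 1

open Classical in
/-- The dual basis `D` of the basis `b` determined by `τ`, built from the inverse of the Gram matrix
`(τ (b i * b j))`. For a symmetrizing trace it is the only family with `τ (D j * b i) = δ i j`, see
`trace_dualBasis_mul` and `eq_dualBasis`. -/
noncomputable def dualBasis {ι : Type*} [Fintype ι] (τ : A →ₗ[R] R) (b : Module.Basis ι R A)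
    (j : ι) : A :=
  ∑ k, (Matrix.of fun i j => τ (b i * b j))⁻¹ j k • b k

open Classical in
theorem isUnit_gram {ι : Type*} [Fintype ι] {τ : A →ₗ[R] R}
    (hτ : IsSymmetrizingTrace τ) (b : Module.Basis ι R A) :
    IsUnit (Matrix.of fun i j => τ (b i * b j)).det := by
  obtain ⟨f, hf, h1⟩ := hτ
  obtain ⟨n, c, hc⟩ := hf.nondegenerate
  have key : ∀ x y, τ (x * y) = f x y := fun x y => by rw [h1, hf.assoc, mul_one]
  simp only [key]
  rcases subsingleton_or_nontrivial R with hR | hR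
  · exact isUnit_of_subsingleton _
  · let c' := c.reindex (c.indexEquiv b)
    have hc' : IsUnit (LinearMap.BilinForm.toMatrix c' f).det := by
      have : LinearMap.BilinForm.toMatrix c' f
          = Matrix.reindex (c.indexEquiv b) (c.indexEquiv b)
            (Matrix.of fun i j => f (c i) (c j)) := by
        ext i j
        simp [c', LinearMap.BilinForm.toMatrix_apply]
      rw [this, Matrix.det_reindex_self]
      exact hc
    have h2 : (Matrix.of fun i j => f (b i) (b j)) = LinearMap.BilinForm.toMatrix b f := by
      ext i j
      simp [LinearMap.BilinForm.toMatrix_apply]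
    have h3 : IsUnit (c'.toMatrix b).det := by
      refine IsUnit.of_mul_eq_one (b.toMatrix c').det ?_
      rw [← Matrix.det_mul, Module.Basis.toMatrix_mul_toMatrix_flip, Matrix.det_one]
    rw [h2, ← LinearMap.BilinForm.toMatrix_mul_basis_toMatrix c' b f, Matrix.det_mul,
      Matrix.det_mul, Matrix.det_transpose]
    exact (h3.mul hc').mul h3

open Classical in
theorem trace_dualBasis_mul {ι : Type*} [Fintype ι] {τ : A →ₗ[R] R}
    (hτ : IsSymmetrizingTrace τ) (b : Module.Basis ι R A) (i j : ι) :
    τ (dualBasis τ b j * b i) = if i = j then 1 else 0 := by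
  have h := congrFun (congrFun (Matrix.nonsing_inv_mul _ (isUnit_gram hτ b)) j) i
  rw [Matrix.mul_apply, Matrix.one_apply] at h
  simp only [dualBasis, Finset.sum_mul, map_sum, smul_mul_assoc, map_smul, smul_eq_mul]
  simpa [eq_comm] using h

open Classical in
theorem eq_dualBasis {ι : Type*} [Fintype ι] {τ : A →ₗ[R] R}
    (hτ : IsSymmetrizingTrace τ) (b : Module.Basis ι R A) (D : ι → A)
    (hD : ∀ i j, τ (D j * b i) = if i = j then 1 else 0) : D = dualBasis τ b := by
  funext j
  have h0 : ∀ i, τ ((D j - dualBasis τ b j) * b i) = 0 := fun i => by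
    rw [sub_mul, map_sub, hD, trace_dualBasis_mul hτ, sub_self]
  rw [← sub_eq_zero, ← b.sum_repr (D j - dualBasis τ b j)]
  have h1 : Matrix.vecMul (fun k => b.repr (D j - dualBasis τ b j) k)
      (Matrix.of fun i j => τ (b i * b j)) = 0 := by
    funext i
    have := h0 i
    rw [← b.sum_repr (D j - dualBasis τ b j)] at this
    simpa [Finset.sum_mul, Matrix.vecMul, dotProduct] using this
  have h2 := congrArg
    (fun v => Matrix.vecMul v (Matrix.of fun i j => τ (b i * b j))⁻¹) h1
  simp only [Matrix.vecMul_vecMul, Matrix.mul_nonsing_inv _ (isUnit_gram hτ b),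
    Matrix.vecMul_one, Matrix.zero_vecMul] at h2
  refine Finset.sum_eq_zero fun k _ => ?_
  rw [show b.repr (D j - dualBasis τ b j) k = 0 from congrFun h2 k, zero_smul]

end SymmetricAlgebra

/-- A cell datum `(Λ, M, C, i)` for the `R`-algebra `A`, in the sense of Graham and Lehrer. -/
structure CellDatum (R A Λ : Type*) [CommRing R] [Ring A] [Algebra R A] [PartialOrder Λ]
    [Fintype Λ] (M : Λ → Type*) [∀ l, Fintype (M l)] where
  /-- The cellular basis: `basis ⟨l, S, T⟩` is the element `C_{S,T}^l`. -/
  basis : Module.Basis (Σ l, M l × M l) R A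
  /-- The `R`-linear anti-automorphism `i`. -/
  inv : A →ₗ[R] A
  inv_mul : ∀ a b : A, inv (a * b) = inv b * inv a
  inv_inv : ∀ a : A, inv (inv a) = a
  inv_basis : ∀ (l : Λ) (S T : M l), inv (basis ⟨l, S, T⟩) = basis ⟨l, T, S⟩
  /-- Left multiplication on `C_{S,T}^l` modulo `A(< l)` has coefficients `r = r_a(-, S)` that do
  not depend on `T`. -/
  mul_basis : ∀ (l : Λ) (a : A) (S : M l), ∃ r : M l → R, ∀ T : M l,
    a * basis ⟨l, S, T⟩ - ∑ S' : M l, r S' • basis ⟨l, S', T⟩ ∈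
      Submodule.span R {x : A | ∃ (m : Λ) (U V : M m), m < l ∧ x = basis ⟨m, U, V⟩}

namespace CellDatum

variable {R A Λ : Type*} [CommRing R] [Ring A] [Algebra R A] [PartialOrder Λ]
  [Fintype Λ] {M : Λ → Type*} [∀ l, Fintype (M l)]

/-- The element `D_{S,T}^l` of the dual basis of the cellular basis determined by `τ`. -/
noncomputable def dual (c : CellDatum R A Λ M) (τ : A →ₗ[R] R) (l : Λ) (S T : M l) : A :=
  dualBasis τ c.basis ⟨l, S, T⟩

/-- `x'_l = ∑_T D_{S,T}^l C_{S,T}^l`, computed with a given index `S`. -/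
noncomputable def xPrime (c : CellDatum R A Λ M) (τ : A →ₗ[R] R) (l : Λ) (S : M l) : A :=
  ∑ T : M l, c.dual τ l S T * c.basis ⟨l, S, T⟩

/-- `L(A)'`: the `R`-linear combinations of the elements `x'_l`. (An `l` with `M l` empty
contributes nothing.) -/
noncomputable def LPrime (c : CellDatum R A Λ M) (τ : A →ₗ[R] R) : Submodule R A :=
  Submodule.span R {x : A | ∃ (l : Λ) (S : M l), x = c.xPrime τ l S}

/-- The Higman ideal `H(A) = {∑_{l,S,T} C_{S,T}^l a D_{S,T}^l | a ∈ A}`, as a subset of `A`. -/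
noncomputable def higman (c : CellDatum R A Λ M) (τ : A →ₗ[R] R) : Set A :=
  {x : A | ∃ a : A, x = ∑ l : Λ, ∑ S : M l, ∑ T : M l, c.basis ⟨l, S, T⟩ * a * c.dual τ l S T}

end CellDatum

/-- The relation "isomorphic as `A`-modules" on simple left `A`-modules. -/
def simpleSetoid.{u} (A : Type u) [Ring A] :
    Setoid {V : ModuleCat.{u} A // IsSimpleModule A V} where
  r V W := Nonempty (V.1 ≃ₗ[A] W.1)
  iseqv :=
    { refl := fun V => ⟨LinearEquiv.refl A V.1⟩
      symm := fun ⟨e⟩ => ⟨e.symm⟩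
      trans := fun ⟨e⟩ ⟨e'⟩ => ⟨e.trans e'⟩ }

/-- The isomorphism classes of simple left `A`-modules. Modules are taken in the universe of `A`,
which is enough since a simple module is a quotient of `A`. -/
def SimpleClass.{u} (A : Type u) [Ring A] : Type (u + 1) := Quotient (simpleSetoid A)

end SymCell

/-!
Write `M_l(a)` for the matrix of `a` on the left cell module of `l` (`actMatrix`), `χ_l` for its
trace and `i` for the anti-automorphism. Applying `i` to the cellular axiom gives the right-handed
version, so `C_{S,T} a` has coefficients `M_l(i a)` modulo lower cells. As `τ (D_j x)` is the
coordinate of `x` at `j`, the element `x'_l` represents the function `χ_l ∘ i` with respect to `τ`,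
that is `τ (x'_l a) = χ_l (i a)` (`trace_xPrime_mul`). Non-degeneracy of `τ` reduces the first two
claims to this formula:

* the right side does not mention `S`, and `χ_l ∘ i` is a trace function, so `x'_l` is well defined
  and central;
* a central element `z` acts on each cell module by a scalar, since its left and its right action
  agree (`actMatrix_inv_of_mem_center`), so `z x'_l` is a multiple of `x'_l`;
* the Casimir element `∑ C ⊗ D` is symmetric, and the coefficient of `C_{S,T}` in `a C_{S,T} b` is a
  product of diagonal entries of `M_l(a)` and `M_l(i b)`, which gives
  `∑ C a D = ∑_l χ_l(a) x'_l`;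
* another symmetrizing trace is `τ (u · -)` with `u` central, and then `x'_l` for `τ` is `u` times
  `x'_l` for the other trace.

Over a field, let `φ_l` be the bilinear form with `C_{S,T} C_{U,V} ≡ φ_l(T,U) C_{S,V}` modulo lower
cells. If `φ_l(T,U) ≠ 0`, then `χ_m (C_{U,T}^l)` vanishes unless `m ≤ l` and equals `φ_l(T,U)` for
`m = l`, so the `x'_l` with `φ_l ≠ 0` are linearly independent (`linearIndependent_xPrime`). To a
simple module one attaches a minimal `l` whose cell does not annihilate it; then `φ_l ≠ 0`, and `l`
determines the module, because `C_{U,T}` is a quasi-idempotent `e` such that `e a e` acts as a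
scalar multiple of `e`, with a scalar depending on `a` only (`nonempty_linearEquiv`).
-/

namespace SymCell

/-! ### Dual bases in a symmetric algebra -/

section SymmetricAlgebra

variable {R A : Type*} [CommRing R] [Ring A] [Algebra R A] {τ : A →ₗ[R] R}

theorem IsSymmetrizingTrace.mul_comm (hτ : IsSymmetrizingTrace τ) (a b : A) :
    τ (a * b) = τ (b * a) := by
  obtain ⟨f, hf, h1⟩ := hτ
  rw [h1, h1, hf.assoc, hf.assoc, mul_one, mul_one, hf.symm]

variable {ι : Type*} [Fintype ι]

theorem trace_dualBasis_mul_eq_repr (hτ : IsSymmetrizingTrace τ) (b : Module.Basis ι R A) (j : ι)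
    (x : A) : τ (dualBasis τ b j * x) = b.repr x j := by
  classical
  conv_lhs => rw [← b.sum_repr x]
  simp only [Finset.mul_sum, map_sum, mul_smul_comm, map_smul, trace_dualBasis_mul hτ]
  simp

theorem eq_of_trace_mul_eq (hτ : IsSymmetrizingTrace τ) (b : Module.Basis ι R A) {x y : A}
    (h : ∀ a, τ (x * a) = τ (y * a)) : x = y := by
  refine b.repr.injective (Finsupp.ext fun j => ?_)
  rw [← trace_dualBasis_mul_eq_repr hτ, ← trace_dualBasis_mul_eq_repr hτ, hτ.mul_comm, h,
    hτ.mul_comm]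

/-- Symmetry of the Casimir element `∑ b_i ⊗ D_i`. -/
theorem sum_basis_mul_dualBasis (hτ : IsSymmetrizingTrace τ) (b : Module.Basis ι R A) (a : A) :
    ∑ i, b i * a * dualBasis τ b i = ∑ i, dualBasis τ b i * a * b i := by
  refine eq_of_trace_mul_eq hτ b fun y => ?_
  have expand : ∀ i, dualBasis τ b i
      = ∑ j, τ (dualBasis τ b i * dualBasis τ b j) • b j := fun i => by
    conv_lhs => rw [← b.sum_repr (dualBasis τ b i)]
    refine Finset.sum_congr rfl fun j _ => ?_
    rw [← trace_dualBasis_mul_eq_repr hτ, hτ.mul_comm]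
  have h1 : ∀ i, τ (b i * a * dualBasis τ b i * y)
      = ∑ j, τ (dualBasis τ b i * dualBasis τ b j) * τ (b i * a * b j * y) := fun i => by
    conv_lhs => rw [expand i]
    simp [Finset.mul_sum, Finset.sum_mul]
  have h2 : ∀ i, τ (dualBasis τ b i * a * b i * y)
      = ∑ j, τ (dualBasis τ b i * dualBasis τ b j) * τ (b j * a * b i * y) := fun i => by
    conv_lhs => rw [expand i]
    simp [Finset.sum_mul]
  simp only [Finset.sum_mul, map_sum, h1, h2]
  rw [Finset.sum_comm]
  refine Finset.sum_congr rfl fun i _ => Finset.sum_congr rfl fun j _ => ?_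
  rw [hτ.mul_comm (dualBasis τ b j)]

/-- Two symmetrizing traces differ by a central factor. -/
theorem exists_mem_center_trace_eq (hτ : IsSymmetrizingTrace τ) (b : Module.Basis ι R A)
    {τ' : A →ₗ[R] R} (hτ' : IsSymmetrizingTrace τ') :
    ∃ u ∈ Subalgebra.center R A, ∀ x, τ' x = τ (u * x) := by
  have key : ∀ x, τ' x = τ ((∑ i, τ' (b i) • dualBasis τ b i) * x) := fun x => by
    conv_lhs => rw [← b.sum_repr x]
    simp only [map_sum, map_smul, smul_eq_mul, Finset.sum_mul, smul_mul_assoc,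
      trace_dualBasis_mul_eq_repr hτ, _root_.mul_comm]
  refine ⟨_, Subalgebra.mem_center_iff.2 fun a => eq_of_trace_mul_eq hτ b fun y => ?_, key⟩
  rw [mul_assoc, hτ.mul_comm a, mul_assoc, ← key, mul_assoc, ← key, hτ'.mul_comm]

end SymmetricAlgebra

namespace CellDatum

section CommRing

variable {R A Λ : Type*} [CommRing R] [Ring A] [Algebra R A] [PartialOrder Λ]
  [Fintype Λ] {M : Λ → Type*} [∀ l, Fintype (M l)] (c : CellDatum R A Λ M)

/-! ### Spans of cells and the action on cell modules -/

/-- The `R`-span of the cells indexed by `J`, described by the vanishing of coordinates outside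
`J`. -/
def cellSpan (J : Set Λ) : Submodule R A where
  carrier := {x | ∀ i, i.1 ∉ J → c.basis.repr x i = 0}
  zero_mem' := fun i _ => by simp
  add_mem' := fun {x y} hx hy i hi => by simp [hx i hi, hy i hi]
  smul_mem' := fun r x hx i hi => by simp [hx i hi]

variable {c}

theorem basis_mem_cellSpan {J : Set Λ} {l : Λ} (hl : l ∈ J) (S T : M l) :
    c.basis ⟨l, S, T⟩ ∈ c.cellSpan J := by
  classical
  intro i hi
  rw [c.basis.repr_self, Finsupp.single_apply, if_neg]
  rintro rfl
  exact hi hl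

theorem cellSpan_le {J : Set Λ} {N : Submodule R A}
    (h : ∀ l ∈ J, ∀ S T : M l, c.basis ⟨l, S, T⟩ ∈ N) : c.cellSpan J ≤ N := by
  intro x hx
  rw [← c.basis.sum_repr x]
  refine N.sum_mem fun i _ => ?_
  by_cases hi : i.1 ∈ J
  · exact N.smul_mem _ (h i.1 hi i.2.1 i.2.2)
  · rw [hx i hi, zero_smul]
    exact N.zero_mem

theorem cellSpan_mono {J K : Set Λ} (h : J ⊆ K) : c.cellSpan J ≤ c.cellSpan K :=
  cellSpan_le fun _ hl => basis_mem_cellSpan (h hl)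

variable (c)

open Classical in
/-- The matrix of `a` on the left cell module of `l`. The coefficient is read off from
`a C_{S,S}`; by the cellular axiom, any second index would do, see `repr_mul_basis`. -/
noncomputable def actMatrix (l : Λ) (a : A) : Matrix (M l) (M l) R :=
  Matrix.of fun S' S => c.basis.repr (a * c.basis ⟨l, S, S⟩) ⟨l, S', S⟩

theorem repr_sum_basis_left {l : Λ} (r : M l → R) (T S' T' : M l) [DecidableEq (M l)] :
    c.basis.repr (∑ S, r S • c.basis ⟨l, S, T⟩) ⟨l, S', T'⟩ = if T' = T then r S' else 0 := by
  classical
  have h : ∀ S : M l, ((⟨l, S, T⟩ : Σ l, M l × M l) = ⟨l, S', T'⟩) ↔ (S = S' ∧ T = T') := by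
    intro S; simp
  simp [Finsupp.single_apply, h, ite_and, eq_comm]

theorem mul_basis_sub_mem (l : Λ) (a : A) (S T : M l) :
    a * c.basis ⟨l, S, T⟩ - ∑ S', c.actMatrix l a S' S • c.basis ⟨l, S', T⟩
      ∈ c.cellSpan (Set.Iio l) := by
  classical
  obtain ⟨r, hr⟩ := c.mul_basis l a S
  have hr' : ∀ T, a * c.basis ⟨l, S, T⟩ - ∑ S', r S' • c.basis ⟨l, S', T⟩
      ∈ c.cellSpan (Set.Iio l) := fun T =>
    Submodule.span_le.2 (by rintro x ⟨m, U, V, hm, rfl⟩; exact basis_mem_cellSpan (J := Set.Iio l) hm U V) (hr T)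
  have : ∀ S', c.actMatrix l a S' S = r S' := fun S' => by
    have h := hr' S ⟨l, S', S⟩ (by simp)
    rw [map_sub, Finsupp.sub_apply, repr_sum_basis_left, if_pos rfl] at h
    exact sub_eq_zero.1 h
  simpa only [this] using hr' T

open Classical in
theorem repr_mul_basis (l : Λ) (a : A) (S T S' T' : M l) :
    c.basis.repr (a * c.basis ⟨l, S, T⟩) ⟨l, S', T'⟩
      = if T' = T then c.actMatrix l a S' S else 0 := by
  have h := c.mul_basis_sub_mem l a S T ⟨l, S', T'⟩ (by simp)
  rw [map_sub, Finsupp.sub_apply, repr_sum_basis_left] at h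
  exact sub_eq_zero.1 h

variable {c}

theorem mul_mem_cellSpan {J : Set Λ} (hJ : IsLowerSet J) (a : A) {x : A}
    (hx : x ∈ c.cellSpan J) : a * x ∈ c.cellSpan J := by
  refine (cellSpan_le (N := (c.cellSpan J).comap (LinearMap.mulLeft R a)) fun l hl S T => ?_) hx
  have h := cellSpan_mono (fun m hm => hJ (le_of_lt hm) hl) (c.mul_basis_sub_mem l a S T)
  have h2 := (c.cellSpan J).sum_mem (t := Finset.univ) fun S' _ =>
    (c.cellSpan J).smul_mem (c.actMatrix l a S' S) (basis_mem_cellSpan hl S' T)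
  simpa using (c.cellSpan J).add_mem h h2

theorem inv_mem_cellSpan {J : Set Λ} {x : A} (hx : x ∈ c.cellSpan J) :
    c.inv x ∈ c.cellSpan J := by
  refine (cellSpan_le (N := (c.cellSpan J).comap c.inv) fun l hl S T => ?_) hx
  rw [Submodule.mem_comap, c.inv_basis]
  exact basis_mem_cellSpan hl T S

theorem mul_mem_cellSpan_right {J : Set Λ} (hJ : IsLowerSet J) (a : A) {x : A}
    (hx : x ∈ c.cellSpan J) : x * a ∈ c.cellSpan J := by
  have h := inv_mem_cellSpan (mul_mem_cellSpan hJ (c.inv a) (inv_mem_cellSpan hx))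
  rwa [c.inv_mul, c.inv_inv, c.inv_inv] at h

variable (c)

theorem repr_inv (x : A) (l : Λ) (S T : M l) :
    c.basis.repr (c.inv x) ⟨l, S, T⟩ = c.basis.repr x ⟨l, T, S⟩ := by
  classical
  suffices h : (c.basis.coord ⟨l, S, T⟩).comp c.inv = c.basis.coord ⟨l, T, S⟩ from
    LinearMap.congr_fun h x
  refine c.basis.ext fun ⟨m, U, V⟩ => ?_
  rw [LinearMap.comp_apply, c.inv_basis, Module.Basis.coord_apply, Module.Basis.coord_apply,
    c.basis.repr_self, c.basis.repr_self, Finsupp.single_apply, Finsupp.single_apply]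
  congr 1
  by_cases h : m = l
  · subst h
    simp [and_comm]
  · simp [h]

open Classical in
/-- Right multiplication, obtained from `repr_mul_basis` by the anti-automorphism. -/
theorem repr_basis_mul (l : Λ) (a : A) (S T S' T' : M l) :
    c.basis.repr (c.basis ⟨l, S, T⟩ * a) ⟨l, S', T'⟩
      = if S' = S then c.actMatrix l (c.inv a) T' T else 0 := by
  rw [← c.repr_mul_basis, ← c.inv_basis l S T, ← c.inv_mul, c.repr_inv]

theorem repr_mul_basis_mul (l : Λ) (a b : A) (S T : M l) :
    c.basis.repr (a * c.basis ⟨l, S, T⟩ * b) ⟨l, S, T⟩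
      = c.actMatrix l a S S * c.actMatrix l (c.inv b) T T := by
  classical
  have h := mul_mem_cellSpan_right (isLowerSet_Iio l) b (c.mul_basis_sub_mem l a S T)
    ⟨l, S, T⟩ (by simp)
  rw [sub_mul, map_sub, Finsupp.sub_apply, sub_eq_zero] at h
  simp [h, Finset.sum_mul, repr_basis_mul]

theorem actMatrix_mul (l : Λ) (a b : A) :
    c.actMatrix l (a * b) = c.actMatrix l a * c.actMatrix l b := by
  classical
  ext S' S
  have h := mul_mem_cellSpan (isLowerSet_Iio l) a (c.mul_basis_sub_mem l b S S)
    ⟨l, S', S⟩ (by simp)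
  rw [mul_sub, map_sub, Finsupp.sub_apply, sub_eq_zero, ← mul_assoc, repr_mul_basis,
    if_pos rfl] at h
  simp [h, Finset.mul_sum, repr_mul_basis, Matrix.mul_apply, _root_.mul_comm]

open Classical in
/-- A central element acts on the left and on the right cell module by the same scalar. -/
theorem actMatrix_inv_of_mem_center {z : A} (hz : z ∈ Subalgebra.center R A) (l : Λ) (S : M l) :
    c.actMatrix l (c.inv z) = c.actMatrix l z S S • (1 : Matrix (M l) (M l) R) := by
  ext T' T
  have h := c.repr_basis_mul l z S T S T'
  rw [Subalgebra.mem_center_iff.1 hz, repr_mul_basis, if_pos rfl] at h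
  simp [← h, Matrix.one_apply]

/-! ### The elements `x'_l` -/

variable {c} {τ : A →ₗ[R] R}

theorem trace_xPrime_mul (hτ : IsSymmetrizingTrace τ) (l : Λ) (S : M l) (a : A) :
    τ (c.xPrime τ l S * a) = (c.actMatrix l (c.inv a)).trace := by
  classical
  simp [xPrime, dual, Finset.sum_mul, mul_assoc, trace_dualBasis_mul_eq_repr hτ, repr_basis_mul,
    Matrix.trace]

theorem xPrime_eq_xPrime (hτ : IsSymmetrizingTrace τ) (l : Λ) (S S' : M l) :
    c.xPrime τ l S = c.xPrime τ l S' :=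
  eq_of_trace_mul_eq hτ c.basis fun a => by rw [trace_xPrime_mul hτ, trace_xPrime_mul hτ]

theorem xPrime_mem_center (hτ : IsSymmetrizingTrace τ) (l : Λ) (S : M l) :
    c.xPrime τ l S ∈ Subalgebra.center R A := by
  refine Subalgebra.mem_center_iff.2 fun a => eq_of_trace_mul_eq hτ c.basis fun y => ?_
  rw [mul_assoc, hτ.mul_comm a, mul_assoc, mul_assoc, trace_xPrime_mul hτ, trace_xPrime_mul hτ,
    c.inv_mul, c.inv_mul, actMatrix_mul, actMatrix_mul, Matrix.trace_mul_comm]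

theorem LPrime_le_center (hτ : IsSymmetrizingTrace τ) :
    c.LPrime τ ≤ Subalgebra.toSubmodule (Subalgebra.center R A) :=
  Submodule.span_le.2 (by rintro x ⟨l, S, rfl⟩; exact xPrime_mem_center hτ l S)

theorem mul_xPrime_of_mem_center (hτ : IsSymmetrizingTrace τ) {z : A}
    (hz : z ∈ Subalgebra.center R A) (l : Λ) (S : M l) :
    z * c.xPrime τ l S = c.actMatrix l z S S • c.xPrime τ l S := by
  classical
  refine eq_of_trace_mul_eq hτ c.basis fun y => ?_
  rw [← Subalgebra.mem_center_iff.1 hz, mul_assoc, trace_xPrime_mul hτ, c.inv_mul, actMatrix_mul,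
    c.actMatrix_inv_of_mem_center hz l S, smul_mul_assoc, map_smul, trace_xPrime_mul hτ]
  simp

theorem mul_mem_LPrime (hτ : IsSymmetrizingTrace τ) {z x : A}
    (hz : z ∈ Subalgebra.center R A) (hx : x ∈ c.LPrime τ) : z * x ∈ c.LPrime τ := by
  suffices h : c.LPrime τ ≤ (c.LPrime τ).comap (LinearMap.mulLeft R z) from h hx
  refine Submodule.span_le.2 ?_
  rintro x ⟨l, S, rfl⟩
  rw [SetLike.mem_coe, Submodule.mem_comap, LinearMap.mulLeft_apply,
    mul_xPrime_of_mem_center hτ hz]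
  exact Submodule.smul_mem _ _ (Submodule.subset_span ⟨l, S, rfl⟩)

theorem higman_sum_eq (hτ : IsSymmetrizingTrace τ) (a : A) :
    ∑ l : Λ, ∑ S : M l, ∑ T : M l, c.basis ⟨l, S, T⟩ * a * c.dual τ l S T
      = ∑ l : Λ, ∑ S : M l, c.actMatrix l a S S • c.xPrime τ l S := by
  have h1 := sum_basis_mul_dualBasis hτ c.basis a
  simp only [Fintype.sum_sigma, Fintype.sum_prod_type] at h1
  refine Eq.trans h1 (eq_of_trace_mul_eq hτ c.basis fun y => ?_)
  have h2 : ∀ (l : Λ) (S T : M l), τ (dualBasis τ c.basis ⟨l, S, T⟩ * a * c.basis ⟨l, S, T⟩ * y)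
      = c.actMatrix l a S S * c.actMatrix l (c.inv y) T T := fun l S T => by
    rw [← repr_mul_basis_mul, ← trace_dualBasis_mul_eq_repr hτ]
    simp only [mul_assoc]
  simp only [Finset.sum_mul, map_sum, h2, smul_mul_assoc, map_smul, trace_xPrime_mul hτ,
    Matrix.trace, smul_eq_mul, Finset.mul_sum, Matrix.diag_apply]

theorem higman_subset_LPrime (hτ : IsSymmetrizingTrace τ) :
    c.higman τ ⊆ (c.LPrime τ : Set A) := by
  rintro x ⟨a, rfl⟩
  rw [higman_sum_eq hτ]
  exact Submodule.sum_mem _ fun l _ => Submodule.sum_mem _ fun S _ =>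
    Submodule.smul_mem _ _ (Submodule.subset_span ⟨l, S, rfl⟩)

theorem LPrime_le_LPrime (hτ : IsSymmetrizingTrace τ) {τ' : A →ₗ[R] R}
    (hτ' : IsSymmetrizingTrace τ') : c.LPrime τ ≤ c.LPrime τ' := by
  obtain ⟨u, hu, h⟩ := exists_mem_center_trace_eq hτ c.basis hτ'
  refine Submodule.span_le.2 ?_
  rintro x ⟨l, S, rfl⟩
  have : c.xPrime τ l S = u * c.xPrime τ' l S := eq_of_trace_mul_eq hτ c.basis fun y => by
    rw [mul_assoc, ← h, trace_xPrime_mul hτ, trace_xPrime_mul hτ']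
  rw [this]
  exact mul_mem_LPrime hτ' hu (Submodule.subset_span ⟨l, S, rfl⟩)

/-! ### The bilinear form of a cell -/

variable (c)

/-- The bilinear form `φ_l` of Graham and Lehrer on the cell module of `l`, evaluated at basis
vectors: `C_{S,T} C_{U,V} ≡ φ_l(T,U) C_{S,V}` modulo lower cells. The definition takes `S = U`, so
that `φ_l(T,U)` is the diagonal entry at `U` of the matrix of `C_{U,T}`; the other diagonal entries
vanish by `actMatrix_basis`. -/
noncomputable def cellForm (l : Λ) (T U : M l) : R :=
  c.actMatrix l (c.basis ⟨l, U, T⟩) U U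

open Classical in
theorem actMatrix_basis (l : Λ) (S T S' U : M l) :
    c.actMatrix l (c.basis ⟨l, S, T⟩) S' U = if S' = S then c.cellForm l T U else 0 := by
  -- The product `C_{S,T} C_{U,U}` computed from the left and from the right.
  have h1 : ∀ S S', c.actMatrix l (c.basis ⟨l, S, T⟩) S' U
      = if S' = S then c.actMatrix l (c.inv (c.basis ⟨l, U, U⟩)) U T else 0 := fun S S' => by
    rw [← c.repr_basis_mul, c.repr_mul_basis, if_pos rfl]
  rw [h1, cellForm, h1 U U, if_pos rfl]

theorem trace_actMatrix_basis (l : Λ) (U T : M l) :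
    (c.actMatrix l (c.basis ⟨l, U, T⟩)).trace = c.cellForm l T U := by
  classical
  simp [Matrix.trace, actMatrix_basis]

theorem actMatrix_basis_of_not_le {l m : Λ} (h : ¬ m ≤ l) (S T : M l) :
    c.actMatrix m (c.basis ⟨l, S, T⟩) = 0 := by
  ext U V
  exact mul_mem_cellSpan_right (isLowerSet_Iic l) _
    (basis_mem_cellSpan (Set.mem_Iic.2 le_rfl) S T) ⟨m, U, V⟩ h

/-! ### Modules annihilated by the cells below a given one -/

section Module

variable {V : Type*} [AddCommGroup V] [Module R V] [Module A V] [IsScalarTower R A V]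

variable {c}

theorem smul_eq_zero_of_mem_cellSpan {J : Set Λ}
    (hJ : ∀ l ∈ J, ∀ (S T : M l) (v : V), c.basis ⟨l, S, T⟩ • v = 0) {x : A}
    (hx : x ∈ c.cellSpan J) (v : V) : x • v = 0 :=
  cellSpan_le (N := LinearMap.ker ((LinearMap.toSpanSingleton A V v).restrictScalars R))
    (fun l hl S T => hJ l hl S T v) hx

theorem smul_basis_smul {l : Λ} (hl : ∀ m < l, ∀ (S T : M m) (v : V), c.basis ⟨m, S, T⟩ • v = 0)
    (a : A) (S T : M l) (v : V) :
    a • c.basis ⟨l, S, T⟩ • v = ∑ S', c.actMatrix l a S' S • c.basis ⟨l, S', T⟩ • v := by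
  have h := smul_eq_zero_of_mem_cellSpan (J := Set.Iio l) hl (c.mul_basis_sub_mem l a S T) v
  rw [sub_smul, sub_eq_zero, mul_smul, Finset.sum_smul] at h
  simpa only [smul_assoc] using h

theorem basis_smul_basis_smul {l : Λ}
    (hl : ∀ m < l, ∀ (S T : M m) (v : V), c.basis ⟨m, S, T⟩ • v = 0)
    (S T U W : M l) (v : V) :
    c.basis ⟨l, S, T⟩ • c.basis ⟨l, U, W⟩ • v = c.cellForm l T U • c.basis ⟨l, S, W⟩ • v := by
  classical
  simp [smul_basis_smul hl, actMatrix_basis]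

/-- `C_{U,T} a C_{U,T}` acts as a scalar multiple of `C_{U,T}`, with a scalar that depends on `a`
but not on the module. -/
theorem basis_smul_smul_basis_smul {l : Λ}
    (hl : ∀ m < l, ∀ (S T : M m) (v : V), c.basis ⟨m, S, T⟩ • v = 0)
    (a : A) (U T : M l) (v : V) :
    c.basis ⟨l, U, T⟩ • a • c.basis ⟨l, U, T⟩ • v
      = (∑ S', c.actMatrix l a S' U * c.cellForm l T S') • c.basis ⟨l, U, T⟩ • v := by
  rw [smul_basis_smul hl, Finset.smul_sum, Finset.sum_smul]
  refine Finset.sum_congr rfl fun S' _ => ?_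
  rw [smul_algebra_smul_comm, basis_smul_basis_smul hl, mul_smul]

end Module

end CommRing

/-! ### Simple modules over a field -/

section Field

variable {R A Λ : Type*} [Field R] [Ring A] [Algebra R A] [PartialOrder Λ]
  [Fintype Λ] {M : Λ → Type*} [∀ l, Fintype (M l)] {c : CellDatum R A Λ M} {τ : A →ₗ[R] R}

theorem linearIndependent_xPrime (hτ : IsSymmetrizingTrace τ) (s : Set Λ) (U T : ∀ l : s, M l)
    (h : ∀ l : s, c.cellForm l (T l) (U l) ≠ 0) :
    LinearIndependent R fun l : s => c.xPrime τ l (U l) := by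
  classical
  rw [Fintype.linearIndependent_iff]
  intro g hg
  by_contra! hne
  obtain ⟨l, hl0, hmin⟩ := (Set.toFinite {l | g l ≠ 0}).exists_minimal hne
  -- Pairing the relation with `i (C_{U,T}^l)` leaves only the term of a minimal `l`.
  have key := congrArg (fun x => τ (x * c.inv (c.basis ⟨l, U l, T l⟩))) hg
  simp only [Finset.sum_mul, map_sum, smul_mul_assoc, map_smul, trace_xPrime_mul hτ, c.inv_inv,
    zero_mul, map_zero, smul_eq_mul] at key
  rw [Finset.sum_eq_single l, trace_actMatrix_basis] at key
  · exact (mul_ne_zero hl0 (h l)) key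
  · intro m _ hm
    by_cases hml : (m : Λ) ≤ l
    · by_cases hgm : g m = 0
      · rw [hgm, zero_mul]
      · exact absurd (Subtype.ext (le_antisymm hml (hmin hgm hml))) hm
    · rw [actMatrix_basis_of_not_le c hml, Matrix.trace_zero, mul_zero]
  · simp

section Module

variable {V W : Type*} [AddCommGroup V] [Module R V] [Module A V] [IsScalarTower R A V]
  [AddCommGroup W] [Module R W] [Module A W] [IsScalarTower R A W]

/-- A minimal cell not annihilating a simple module has nonzero bilinear form. -/
theorem exists_cell_of_isSimpleModule [IsSimpleModule A V] :
    ∃ l : Λ, (∀ m < l, ∀ (S T : M m) (v : V), c.basis ⟨m, S, T⟩ • v = 0) ∧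
      (∃ (S T : M l) (v : V), c.basis ⟨l, S, T⟩ • v ≠ 0) ∧
      ∃ T U : M l, c.cellForm l T U ≠ 0 := by
  have hne : {l : Λ | ∃ (S T : M l) (v : V), c.basis ⟨l, S, T⟩ • v ≠ 0}.Nonempty := by
    by_contra hcon
    have := IsSimpleModule.nontrivial A V
    obtain ⟨v, hv⟩ := exists_ne (0 : V)
    refine hv ?_
    have : ∀ l ∈ (Set.univ : Set Λ), ∀ (S T : M l) (v : V), c.basis ⟨l, S, T⟩ • v = 0 := by
      intro l _ S T v
      by_contra h
      exact hcon ⟨l, S, T, v, h⟩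
    simpa using smul_eq_zero_of_mem_cellSpan this (x := (1 : A)) (fun i hi => (hi trivial).elim) v
  obtain ⟨l, ⟨S, T, v, hv⟩, hmin⟩ := (Set.toFinite _).exists_minimal hne
  have hl : ∀ m < l, ∀ (S T : M m) (v : V), c.basis ⟨m, S, T⟩ • v = 0 := by
    intro m hm S T v
    by_contra h
    exact absurd (hmin ⟨S, T, v, h⟩ hm.le) (not_le_of_gt hm)
  refine ⟨l, hl, ⟨S, T, v, hv⟩, T, ?_⟩
  by_contra! h0
  -- `v` is a multiple of `C_{S,T} v`, and `C_{S,T}` kills all such multiples if `φ_l(T,-) = 0`.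
  obtain ⟨a, ha⟩ := IsSimpleModule.toSpanSingleton_surjective A hv v
  rw [LinearMap.toSpanSingleton_apply] at ha
  refine hv ?_
  rw [← ha, basis_smul_smul_basis_smul hl]
  simp [h0]

/-- The quasi-idempotent `C_{U,T}` does not annihilate a module that its cell does not annihilate,
as `C_{P,T} C_{U,T} C_{U,Q}` acts as `φ_l(T,U)² C_{P,Q}`. -/
theorem exists_basis_smul_ne_zero {l : Λ}
    (hl : ∀ m < l, ∀ (S T : M m) (v : V), c.basis ⟨m, S, T⟩ • v = 0)
    (hV : ∃ (S T : M l) (v : V), c.basis ⟨l, S, T⟩ • v ≠ 0) {T U : M l}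
    (h : c.cellForm l T U ≠ 0) : ∃ v : V, c.basis ⟨l, U, T⟩ • v ≠ 0 := by
  obtain ⟨P, Q, v, hv⟩ := hV
  by_contra! h0
  have h1 := basis_smul_basis_smul hl P T U Q v
  have h2 := basis_smul_basis_smul hl U T U Q v
  rw [h0] at h2
  have h3 := (smul_eq_zero.1 h2.symm).resolve_left h
  rw [h3, smul_zero] at h1
  exact (smul_ne_zero h hv) h1.symm

theorem smul_eq_zero_of_smul_eq_zero [IsSimpleModule A W] {l : Λ}
    (hl : ∀ m < l, ∀ (S T : M m) (v : V), c.basis ⟨m, S, T⟩ • v = 0)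
    (hl' : ∀ m < l, ∀ (S T : M m) (w : W), c.basis ⟨m, S, T⟩ • w = 0) {T U : M l}
    (h : c.cellForm l T U ≠ 0) {v : V} {w : W} (hv : c.basis ⟨l, U, T⟩ • v ≠ 0)
    {a : A} (ha : a • c.basis ⟨l, U, T⟩ • v = 0) : a • c.basis ⟨l, U, T⟩ • w = 0 := by
  by_contra hne
  obtain ⟨d, hd⟩ := IsSimpleModule.toSpanSingleton_surjective A hne (c.basis ⟨l, U, T⟩ • w)
  rw [LinearMap.toSpanSingleton_apply, ← mul_smul] at hd
  -- The scalars by which `C d a C` acts on `V` and on `W` agree; the one is `0`, the other is `φ`.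
  have h1 := basis_smul_smul_basis_smul hl' (d * a) U T w
  have h2 := basis_smul_smul_basis_smul hl (d * a) U T v
  rw [mul_smul d a, ha, smul_zero, smul_zero] at h2
  rw [(smul_eq_zero.1 h2.symm).resolve_right hv, hd, basis_smul_basis_smul hl', zero_smul] at h1
  have h3 := (smul_eq_zero.1 h1).resolve_left h
  exact hne (by rw [h3, smul_zero])

/-- A simple module is determined by a minimal cell that does not annihilate it. -/
theorem nonempty_linearEquiv [IsSimpleModule A V] [IsSimpleModule A W] {l : Λ}
    (hl : ∀ m < l, ∀ (S T : M m) (v : V), c.basis ⟨m, S, T⟩ • v = 0)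
    (hV : ∃ (S T : M l) (v : V), c.basis ⟨l, S, T⟩ • v ≠ 0)
    (hl' : ∀ m < l, ∀ (S T : M m) (w : W), c.basis ⟨m, S, T⟩ • w = 0)
    (hW : ∃ (S T : M l) (w : W), c.basis ⟨l, S, T⟩ • w ≠ 0)
    (h : ∃ T U : M l, c.cellForm l T U ≠ 0) : Nonempty (V ≃ₗ[A] W) := by
  obtain ⟨T, U, h⟩ := h
  obtain ⟨v, hv⟩ := exists_basis_smul_ne_zero hl hV h
  obtain ⟨w, hw⟩ := exists_basis_smul_ne_zero hl' hW h
  have hker : LinearMap.ker (LinearMap.toSpanSingleton A V (c.basis ⟨l, U, T⟩ • v))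
      = LinearMap.ker (LinearMap.toSpanSingleton A W (c.basis ⟨l, U, T⟩ • w)) := by
    ext a
    rw [LinearMap.mem_ker, LinearMap.mem_ker, LinearMap.toSpanSingleton_apply,
      LinearMap.toSpanSingleton_apply]
    exact ⟨smul_eq_zero_of_smul_eq_zero hl hl' h hv, smul_eq_zero_of_smul_eq_zero hl' hl h hw⟩
  exact ⟨(LinearMap.quotKerEquivOfSurjective _
      (IsSimpleModule.toSpanSingleton_surjective A hv)).symm ≪≫ₗ Submodule.quotEquivOfEq _ _ hker
    ≪≫ₗ LinearMap.quotKerEquivOfSurjective _ (IsSimpleModule.toSpanSingleton_surjective A hw)⟩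

end Module

theorem finite_simpleClass_and_card_le (c : CellDatum R A Λ M) (hτ : IsSymmetrizingTrace τ) :
    Finite (SimpleClass A) ∧ Nat.card (SimpleClass A) ≤ Module.finrank R (c.LPrime τ) := by
  classical
  let s : Set Λ := {l | ∃ T U : M l, c.cellForm l T U ≠ 0}
  have hs : Nat.card s ≤ Module.finrank R (c.LPrime τ) := by
    choose T U h using fun l : s => l.2
    have hli := linearIndependent_xPrime hτ s U T h
    have : Module.Finite R A := Module.Finite.of_basis c.basis
    rw [Nat.card_eq_fintype_card, ← finrank_span_eq_card hli]
    refine Submodule.finrank_mono (Submodule.span_mono ?_)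
    rintro _ ⟨l, rfl⟩
    exact ⟨l, U l, rfl⟩
  have key : ∀ q : SimpleClass A, ∃ l : Λ,
      (∀ m < l, ∀ (S T : M m) (v : q.out.1), c.basis ⟨m, S, T⟩ • v = 0) ∧
      (∃ (S T : M l) (v : q.out.1), c.basis ⟨l, S, T⟩ • v ≠ 0) ∧
      ∃ T U : M l, c.cellForm l T U ≠ 0 := fun q => by
    have : IsSimpleModule A q.out.1 := q.out.2
    let _ := Module.compHom q.out.1 (algebraMap R A)
    have : IsScalarTower R A q.out.1 := .of_algebraMap_smul fun _ _ => rfl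
    exact exists_cell_of_isSimpleModule
  choose l h1 h2 h3 using key
  have hinj : Function.Injective fun q => (⟨l q, h3 q⟩ : s) := by
    intro p q hpq
    have hlpq : l p = l q := congrArg Subtype.val hpq
    have : IsSimpleModule A p.out.1 := p.out.2
    have : IsSimpleModule A q.out.1 := q.out.2
    let _ := Module.compHom p.out.1 (algebraMap R A)
    let _ := Module.compHom q.out.1 (algebraMap R A)
    have : IsScalarTower R A p.out.1 := .of_algebraMap_smul fun _ _ => rfl
    have : IsScalarTower R A q.out.1 := .of_algebraMap_smul fun _ _ => rfl
    have hp1 := h1 p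
    have hp2 := h2 p
    rw [hlpq] at hp1 hp2
    exact Quotient.out_equiv_out.1 (nonempty_linearEquiv hp1 hp2 (h1 q) (h2 q) (h3 q))
  exact ⟨Finite.of_injective _ hinj, (Nat.card_le_card_of_injective _ hinj).trans hs⟩

end Field

end CellDatum

end SymCell

theorem theorem3p3 {R A Λ : Type*} [CommRing R] [Ring A] [Algebra R A] [PartialOrder Λ]
    [Fintype Λ] {M : Λ → Type*} [∀ l, Fintype (M l)] (c : SymCell.CellDatum R A Λ M)
    (τ : A →ₗ[R] R) (hτ : SymCell.IsSymmetrizingTrace τ) :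
    -- `x'_l` does not depend on the index `S` used to compute it
    (∀ (l : Λ) (S S' : M l), c.xPrime τ l S = c.xPrime τ l S') ∧
    -- `L(A)'` is an ideal of the center and contains the Higman ideal
    (∃ I : Ideal (Subalgebra.center R A),
      (fun z : Subalgebra.center R A => (z : A)) '' (I : Set (Subalgebra.center R A)) =
        (c.LPrime τ : Set A)) ∧
    c.higman τ ⊆ (c.LPrime τ : Set A) ∧
    -- `L(A)'` does not depend on the symmetrizing trace
    (∀ τ' : A →ₗ[R] R, SymCell.IsSymmetrizingTrace τ' → c.LPrime τ' = c.LPrime τ) ∧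
    -- over a field, the dimension is at least the number of simple modules
    (IsField R → Finite (SymCell.SimpleClass A) ∧
      Nat.card (SymCell.SimpleClass A) ≤ Module.finrank R (c.LPrime τ)) := by
  open SymCell SymCell.CellDatum in
  refine ⟨xPrime_eq_xPrime hτ, ⟨{
      carrier := {z | (z : A) ∈ c.LPrime τ}
      zero_mem' := (c.LPrime τ).zero_mem
      add_mem' := (c.LPrime τ).add_mem
      smul_mem' := fun z _ hx => mul_mem_LPrime hτ z.2 hx }, ?_⟩, higman_subset_LPrime hτ,
    fun τ' hτ' => le_antisymm (LPrime_le_LPrime hτ' hτ) (LPrime_le_LPrime hτ hτ'), fun hR => ?_⟩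
  · ext x
    exact ⟨by rintro ⟨z, hz, rfl⟩; exact hz, fun hx => ⟨⟨x, LPrime_le_center hτ hx⟩, hx, rfl⟩⟩
  · let _ := hR.toField
    exact finite_simpleClass_and_card_le c hτ
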